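/- **Conventions.** Let $\mathcal C$ be a $\mathbb C$-linear ribbon category, and write $\mathcal C(n)=\mathrm{Hom}(X^{\otimes n},\mathbf 1)$ for the $n$-box space of an object $X$. A *trivalent ribbon category* $(\mathcal C,X,\tau)$ over $\mathbb C$ is such a $\mathcal C$ together with an object $X$, a self-duality of $X$ (a cap $X\otimes X\to\mathbf 1$ and a cup $\mathbf 1\to X\otimes X$ satisfying the zig-zag equations) and $\tau\in\mathcal C(3)$ such that: $\mathcal C(1)=0$; $\mathcal C(0)$, $\mathcal C(2)$, $\mathcal C(3)$ are one-dimensional, spanned respectively by the empty diagram, the strand (the cap) and $\tau$; $\mathcal C$ is generated as a ribbon category by $\tau$ (every morphism between tensor powers of $X$ is a linear combination of diagrams built from caps, cups, crossings and trivalent vertices $\tau$); the circle equals $d$ times the empty diagram with $d\neq0$; and the bigon equals $b$ times the strand with $b\ne0$. Diagrams are endomorphisms of $X\otimes X$, composed vertically from bottom to top. Let $\mathrm{id}$ be two vertical strands; $\mathsf U$ the cap below the cup; $\mathsf I$ two trivalent vertices joined by a vertical edge; $\mathsf H$ two vertical strands joined by a horizontal rung; $\mathsf S=\mathsf H\circ\mathsf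 H$ the square (4-gon); $\sigma$ the negative crossing (the inverse of the braiding of $X$ with itself) and $\sigma^{-1}$ the positive one; $\mathsf X=\sigma\circ\mathsf H$, i.e. $\mathsf H$ with its two top legs crossed by $\sigma$. Let $\mathsf Y\colon X\otimes X\to X$ be the trivalent vertex; the triangle value $t\in\mathbb C$ is defined by $\mathsf Y\circ\mathsf H=t\,\mathsf Y$. For $v\in\mathbb C^\times$ and $n\in\mathbb Z$ put $[n]=v^n-v^{-n}$, $\{n\}=v^n+v^{-n}$, $\Psi_1=v-v^{-1}$, $\Psi_2=v+v^{-1}$, $\Psi_3=v^2+1+v^{-2}$, $\Psi_4=v^2+v^{-2}$, $\Psi_6=v^2-1+v^{-2}$. For $v\in\mathbb C^\times$ and $\alpha\in\mathbb C$ we say that $\mathcal C$ satisfies (QEJac-$\alpha$) with parameters $v,\alpha$ if $\sigma\circ\mathrm{cup}=v^{12}\,\mathrm{cup}$, $\mathsf Y\circ\sigma=-v^6\,\mathsf Y$, and $$v^{-3}\,\mathsf X+v\,\mathsf I-v^{-1}\,\mathsf H+\alpha\left[\sigma+v^4\,\mathsf U+v^{-4}\,\mathrm{id}\right]=0 .$$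 **Theorem.** Suppose $(\mathcal C,X,\tau)$ is a trivalent ribbon category over $\mathbb C$ with $\dim\mathcal C(4)\le5$ that satisfies (QEJac-$\alpha$) with parameters $v,\alpha$, where $v^{10}\neq1$ and $v^{12}\ne1$. Then $\alpha\ne0$, $b+[3]\alpha\neq0$, $v^8\neq1$, and: * $d=-\dfrac{[5]\,b}{\alpha}-\{8\}$; * $t=\dfrac{b-[5]\alpha}{\{2\}}$; * (QESq-$\alpha$) $$\mathsf S+\frac{\alpha\Psi_6(b+[3]\alpha)}{\Psi_1\Psi_3\Psi_4}\,\sigma+\frac{y_1}{\Psi_3\Psi_4}\,\mathsf I+\frac{y_2}{\Psi_3\Psi_4}\,\mathsf H+\frac{\alpha y_3}{\Psi_1\Psi_3\Psi_4}\,\mathsf U+\frac{\alpha y_4}{\Psi_1\Psi_3\Psi_4}\,\mathrm{id}=0,$$ where $$\begin{aligned} y_1&=-b+(-v^{-5}+v^{-3}+2v+v^3+2v^5+v^7)\alpha,\\ y_2&=-b+(-v^{-7}-2v^{-5}-v^{-3}-2v^{-1}-v^3+v^5)\alpha,\\ y_3&=b+(-v^{-1}+v-v^3+v^5-v^7+v^9)\alpha,\\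 y_4&=b+(-v^{-9}+v^{-7}-v^{-5}+v^{-3}-v^{-1}+v)\alpha; \end{aligned}$$ * (QECross-$\alpha$) $$\sigma-\sigma^{-1}+\frac{\Psi_1\Psi_2\Psi_3\Psi_4}{b+[3]\alpha}\left[\mathsf I-\mathsf H\right]-\frac{\Psi_1^2\Psi_2\Psi_3\Psi_4\,\alpha}{b+[3]\alpha}\left[\mathrm{id}-\mathsf U\right]=0 .$$ -/

import Mathlib

open CategoryTheory MonoidalCategory

universe w u

/-! ### Ribbon categories -/

/-- A ribbon structure on a braided rigid monoidal category: a natural automorphism `θ` of the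
identity functor (the twist) with `θ_{A ⊗ B} = c_{B,A} ∘ c_{A,B} ∘ (θ_A ⊗ θ_B)` which is compatible
with duals, `θ_{A*} = (θ_A)*`. -/
class RibbonCategory (C : Type u) [Category.{w} C] [MonoidalCategory C] [BraidedCategory C]
    [RigidCategory C] where
  /-- the twist -/
  twist : ∀ A : C, A ≅ A
  twist_naturality : ∀ {A B : C} (f : A ⟶ B), f ≫ (twist B).hom = (twist A).hom ≫ f
  twist_tensor : ∀ A B : C, (twist (A ⊗ B)).hom =
    ((twist A).hom ⊗ₘ (twist B).hom) ≫ (β_ A B).hom ≫ (β_ B A).hom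
  twist_dual : ∀ A : C, (twist (Aᘁ)).hom = ((twist A).homᘁ)

/-! ### Trivalent diagrams -/

/-- The data needed to evaluate diagrams with unoriented strands and trivalent vertices: an object
`X`, a self-duality of `X` (a cap and a cup that satisfy the zig-zag equations) and an element `τ`
of the 3-box space `Hom(X ⊗ X ⊗ X, 1)`. No rotational symmetry of the cap or of `τ` is assumed. -/
structure TrivalentDatum (C : Type u) [Category.{w} C] [MonoidalCategory C] where
  /-- the object that labels the strands -/
  X : C
  /-- the self-duality of `X`: its evaluation is the cap, its coevaluation is the cup -/
  selfDual : ExactPairing X X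
  /-- the trivalent vertex, as a 3-box -/
  τ : X ⊗ X ⊗ X ⟶ 𝟙_ C

/-- Boundary words: the bracketed tensor powers of the strand. -/
inductive StrandWord : Type
  | unit : StrandWord
  | strand : StrandWord
  | tensor : StrandWord → StrandWord → StrandWord

/-- Trivalent ribbon diagrams between boundary words, built from the cap, the cup, the crossing,
its inverse and the trivalent vertex by composition and tensor product. -/
inductive RibbonDiagram : StrandWord → StrandWord → Type
  | id (a : StrandWord) : RibbonDiagram a a
  | comp {a b c : StrandWord} : RibbonDiagram a b → RibbonDiagram b c → RibbonDiagram a c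
  | tensor {a b c d : StrandWord} :
      RibbonDiagram a b → RibbonDiagram c d → RibbonDiagram (a.tensor c) (b.tensor d)
  | assoc (a b c : StrandWord) :
      RibbonDiagram ((a.tensor b).tensor c) (a.tensor (b.tensor c))
  | assocInv (a b c : StrandWord) :
      RibbonDiagram (a.tensor (b.tensor c)) ((a.tensor b).tensor c)
  | leftUnitor (a : StrandWord) : RibbonDiagram (StrandWord.unit.tensor a) a
  | leftUnitorInv (a : StrandWord) : RibbonDiagram a (StrandWord.unit.tensor a)
  | rightUnitor (a : StrandWord) : RibbonDiagram (a.tensor StrandWord.unit) a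
  | rightUnitorInv (a : StrandWord) : RibbonDiagram a (a.tensor StrandWord.unit)
  | cap : RibbonDiagram (StrandWord.strand.tensor StrandWord.strand) StrandWord.unit
  | cup : RibbonDiagram StrandWord.unit (StrandWord.strand.tensor StrandWord.strand)
  | crossing : RibbonDiagram (StrandWord.strand.tensor StrandWord.strand)
      (StrandWord.strand.tensor StrandWord.strand)
  | crossingInv : RibbonDiagram (StrandWord.strand.tensor StrandWord.strand)
      (StrandWord.strand.tensor StrandWord.strand)
  | vertex : RibbonDiagram
      (StrandWord.strand.tensor (StrandWord.strand.tensor StrandWord.strand)) StrandWord.unit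

namespace TrivalentDatum

section Planar

variable {C : Type u} [Category.{w} C] [MonoidalCategory C] (T : TrivalentDatum C)

/-- The cap `X ⊗ X ⟶ 1`. -/
def cap : T.X ⊗ T.X ⟶ 𝟙_ C := T.selfDual.evaluation'

/-- The cup `1 ⟶ X ⊗ X`. -/
def cup : 𝟙_ C ⟶ T.X ⊗ T.X := T.selfDual.coevaluation'

/-- The trivalent vertex with two legs at the bottom and one at the top, obtained from `τ` by
bending its right-most leg upwards on the right. -/
def merge : T.X ⊗ T.X ⟶ T.X :=
  𝟙 _ ⊗≫ (T.X ⊗ T.X) ◁ T.cup ⊗≫ T.τ ▷ T.X ⊗≫ 𝟙 _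

/-- The trivalent vertex with one leg at the bottom and two at the top, obtained from `merge` by
bending its right leg upwards on the right. -/
def split : T.X ⟶ T.X ⊗ T.X :=
  𝟙 _ ⊗≫ T.X ◁ T.cup ⊗≫ T.merge ▷ T.X ⊗≫ 𝟙 _

/-- The circle, as an endomorphism of the unit. -/
def circle : 𝟙_ C ⟶ 𝟙_ C := T.cup ≫ T.cap

/-- The bigon, as an endomorphism of the strand. -/
def bigon : T.X ⟶ T.X := T.split ≫ T.merge

/-- The cap below the cup. -/
def cupCap : T.X ⊗ T.X ⟶ T.X ⊗ T.X := T.cap ≫ T.cup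

/-- The diagram `I`: two vertices joined by a vertical edge. -/
def diagI : T.X ⊗ T.X ⟶ T.X ⊗ T.X := T.merge ≫ T.split

/-- The diagram `H`: two vertical strands joined by a rung. It is drawn with the rung leaving the
right strand and joining the left strand above. -/
def diagH : T.X ⊗ T.X ⟶ T.X ⊗ T.X :=
  𝟙 _ ⊗≫ T.X ◁ T.split ⊗≫ T.merge ▷ T.X ⊗≫ 𝟙 _

/-- The square (4-gon), two rungs between two vertical strands. -/
def square : T.X ⊗ T.X ⟶ T.X ⊗ T.X := T.diagH ≫ T.diagH

/-- The triangle (3-gon) with two legs at the bottom and one at the top. -/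
def triangle : T.X ⊗ T.X ⟶ T.X := T.diagH ≫ T.merge

end Planar

section Braided

variable {C : Type u} [Category.{w} C] [MonoidalCategory C] [BraidedCategory C]
  (T : TrivalentDatum C)

/-- The positive crossing, i.e. the braiding. -/
def posCrossing : T.X ⊗ T.X ⟶ T.X ⊗ T.X := (β_ T.X T.X).hom

/-- The negative crossing, i.e. the inverse braiding. Closed up by a cup it is the positive
framing twist. -/
def negCrossing : T.X ⊗ T.X ⟶ T.X ⊗ T.X := (β_ T.X T.X).inv

/-- The third tree diagram: the diagram `H` with its two top legs crossed (negatively). -/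
def diagX : T.X ⊗ T.X ⟶ T.X ⊗ T.X := T.diagH ≫ T.negCrossing

/-- The tensor power of `X` given by a boundary word. -/
def obj : StrandWord → C
  | .unit => 𝟙_ C
  | .strand => T.X
  | .tensor a b => obj a ⊗ obj b

/-- The morphism represented by a diagram. -/
def eval : {a b : StrandWord} → RibbonDiagram a b → (T.obj a ⟶ T.obj b)
  | _, _, .id a => 𝟙 (T.obj a)
  | _, _, .comp f g => eval f ≫ eval g
  | _, _, .tensor f g => eval f ⊗ₘ eval g
  | _, _, .assoc a b c => (α_ (T.obj a) (T.obj b) (T.obj c)).hom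
  | _, _, .assocInv a b c => (α_ (T.obj a) (T.obj b) (T.obj c)).inv
  | _, _, .leftUnitor a => (λ_ (T.obj a)).hom
  | _, _, .leftUnitorInv a => (λ_ (T.obj a)).inv
  | _, _, .rightUnitor a => (ρ_ (T.obj a)).hom
  | _, _, .rightUnitorInv a => (ρ_ (T.obj a)).inv
  | _, _, .cap => T.cap
  | _, _, .cup => T.cup
  | _, _, .crossing => T.posCrossing
  | _, _, .crossingInv => T.negCrossing
  | _, _, .vertex => T.τ

end Braided

end TrivalentDatum

/-! ### Trivalent ribbon categories over `ℂ` -/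

/-- The vector space `M` is free of rank one, generated by `x`. -/
def FreelyGeneratedBy {M : Type*} [AddCommGroup M] [Module ℂ M] (x : M) : Prop :=
  ∀ y : M, ∃! c : ℂ, y = c • x

/-- A trivalent ribbon category `(C, X, τ)` over `ℂ`, where `C` is a `ℂ`-linear ribbon category.
The `n`-box space is `Hom(X^{⊗ n}, 1)`. The strand, as a 2-box, is the cap. Being generated by `τ`
means that every morphism between tensor powers of `X` is a linear combination of diagrams;
objects of `C` other than tensor powers of `X` play no role. -/
structure TrivalentRibbon (C : Type u) [Category.{w} C] [Preadditive C] [Linear ℂ C]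
    [MonoidalCategory C] [MonoidalPreadditive C] [MonoidalLinear ℂ C] [BraidedCategory C]
    [RigidCategory C] [RibbonCategory C] extends TrivalentDatum C where
  box_zero : FreelyGeneratedBy (𝟙 (𝟙_ C))
  box_one : ∀ f : X ⟶ 𝟙_ C, f = 0
  box_two : FreelyGeneratedBy toTrivalentDatum.cap
  box_three : FreelyGeneratedBy τ
  generated : ∀ a b : StrandWord,
    Submodule.span ℂ
      (Set.range (fun D : RibbonDiagram a b => toTrivalentDatum.eval D)) = ⊤
  /-- the value of the circle -/
  d : ℂ
  circle_eq : toTrivalentDatum.circle = d • 𝟙 (𝟙_ C)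
  d_ne_zero : d ≠ 0
  /-- the value of the bigon -/
  b : ℂ
  bigon_eq : toTrivalentDatum.bigon = b • 𝟙 X
  b_ne_zero : b ≠ 0

/-! ### Quantum numbers and coefficients -/

/-- `[n] = v ^ n - v ^ (-n)` (no denominator). -/
noncomputable def qnum (v : ℂ) (n : ℤ) : ℂ := v ^ n - v ^ (-n)

/-- `{n} = v ^ n + v ^ (-n)`. -/
noncomputable def qsum (v : ℂ) (n : ℤ) : ℂ := v ^ n + v ^ (-n)

/-- `Ψ₁(v) = v - v⁻¹`. -/
noncomputable def Psi1 (v : ℂ) : ℂ := v - v ^ (-1 : ℤ)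

/-- `Ψ₂(v) = v + v⁻¹`. -/
noncomputable def Psi2 (v : ℂ) : ℂ := v + v ^ (-1 : ℤ)

/-- `Ψ₃(v) = v² + 1 + v⁻²`. -/
noncomputable def Psi3 (v : ℂ) : ℂ := v ^ 2 + 1 + v ^ (-2 : ℤ)

/-- `Ψ₄(v) = v² + v⁻²`. -/
noncomputable def Psi4 (v : ℂ) : ℂ := v ^ 2 + v ^ (-2 : ℤ)

/-- `Ψ₆(v) = v² - 1 + v⁻²`. -/
noncomputable def Psi6 (v : ℂ) : ℂ := v ^ 2 - 1 + v ^ (-2 : ℤ)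

/-- Coefficient of `I` in the square relation. -/
noncomputable def coeffI (v b α : ℂ) : ℂ :=
  -b + (-v ^ (-5 : ℤ) + v ^ (-3 : ℤ) + 2 * v + v ^ 3 + 2 * v ^ 5 + v ^ 7) * α

/-- Coefficient of `H` in the square relation. -/
noncomputable def coeffH (v b α : ℂ) : ℂ :=
  -b + (-v ^ (-7 : ℤ) - 2 * v ^ (-5 : ℤ) - v ^ (-3 : ℤ) - 2 * v ^ (-1 : ℤ) - v ^ 3 + v ^ 5) * α

/-- Coefficient of the cup-cap diagram in the square relation. -/
noncomputable def coeffCupCap (v b α : ℂ) : ℂ :=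
  b + (-v ^ (-1 : ℤ) + v - v ^ 3 + v ^ 5 - v ^ 7 + v ^ 9) * α

/-- Coefficient of the two vertical strands in the square relation. -/
noncomputable def coeffId (v b α : ℂ) : ℂ :=
  b + (-v ^ (-9 : ℤ) + v ^ (-7 : ℤ) - v ^ (-5 : ℤ) + v ^ (-3 : ℤ) - v ^ (-1 : ℤ) + v) * α

/-! ### The relations -/

namespace TrivalentRibbon

variable {C : Type u} [Category.{w} C] [Preadditive C] [Linear ℂ C]
  [MonoidalCategory C] [MonoidalPreadditive C] [MonoidalLinear ℂ C] [BraidedCategory C]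
  [RigidCategory C] [RibbonCategory C] (T : TrivalentRibbon C)

/-- `C` satisfies the quantum exceptional Jacobi relation with parameters `v` and `α`. This includes
the choice of `v` through the framing twist and the twisted vertex. -/
structure QEJac (v α : ℂ) : Prop where
  twist_eq : T.cup ≫ T.negCrossing = v ^ 12 • T.cup
  twist_vertex_eq : T.negCrossing ≫ T.merge = (-v ^ 6) • T.merge
  jacobi_eq :
    v ^ (-3 : ℤ) • T.diagX + v • T.diagI - v ^ (-1 : ℤ) • T.diagH
      + α • (T.negCrossing + v ^ 4 • T.cupCap + v ^ (-4 : ℤ) • 𝟙 (T.X ⊗ T.X)) = 0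

/-- The quantum exceptional square relation. -/
def QESq (v α : ℂ) : Prop :=
  T.square
    + (α * Psi6 v * (T.b + qnum v 3 * α) / (Psi1 v * Psi3 v * Psi4 v)) • T.negCrossing
    + (coeffI v T.b α / (Psi3 v * Psi4 v)) • T.diagI
    + (coeffH v T.b α / (Psi3 v * Psi4 v)) • T.diagH
    + (α * coeffCupCap v T.b α / (Psi1 v * Psi3 v * Psi4 v)) • T.cupCap
    + (α * coeffId v T.b α / (Psi1 v * Psi3 v * Psi4 v)) • 𝟙 (T.X ⊗ T.X) = 0

/-- The quantum exceptional crossing relation. -/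
def QECross (v α : ℂ) : Prop :=
  T.negCrossing - T.posCrossing
    + (Psi1 v * Psi2 v * Psi3 v * Psi4 v / (T.b + qnum v 3 * α)) • (T.diagI - T.diagH)
    - (Psi1 v ^ 2 * Psi2 v * Psi3 v * Psi4 v * α / (T.b + qnum v 3 * α)) •
        (𝟙 (T.X ⊗ T.X) - T.cupCap) = 0

end TrivalentRibbon

/-! Composing (QEJac-α) with the cup or with `Y` gives scalar equations for `d` and `t`. With `v ^
10 ≠ 1` they exclude `α = 0` and `v ^ 4 = -1`.

The other relations come from the one-click rotation of `End(X ⊗ X)`. It exchanges `id` with `U`,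
`I` with `H` and `σ` with `σ⁻¹`, and it fixes the square `S`. Since `dim C(4) ≤ 5`, these six
diagrams satisfy a nontrivial relation (`exists_relation`). Precomposing any such relation with `H`
gives a multiple of `S` plus a combination of the six, because Jacobi resolves `σ ∘ H` and `σ⁻¹ ∘
H`; subtracting the rotated relation removes `S` (`derived_relation`). Hence there is a nontrivial
relation `A(id - U) + B(I - H) + F(σ - σ⁻¹) = 0`, and it can be chosen with `F ≠ 0`: a planar
relation substituted into Jacobi yields one with a crossing (`exists_crossing_relation`).

The derived relation is again antisymmetric, so a multiple of the original can be added to it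
(`eliminate`). One multiple fixes `A : F`, and the cup then fixes `B`, which is (QECross-α) up to
scale. Another multiple shows that `b + [3]α = 0` would force a planar relation, which is
impossible. Precomposing the crossing relation with `H` once more gives (QESq-α). -/

namespace TrivalentDatum

/-! ### Planar isotopy and rotation. -/

section PlanarCalculus

variable {C : Type u} [Category.{w} C] [MonoidalCategory C] (T : TrivalentDatum C)

theorem zigzag_right : 𝟙 T.X ⊗≫ T.X ◁ T.cup ⊗≫ T.cap ▷ T.X ⊗≫ 𝟙 T.X = 𝟙 T.X := by
  have h := T.selfDual.coevaluation_evaluation'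
  calc _ = (ρ_ T.X).inv ≫ (T.X ◁ T.cup ≫ (α_ _ _ _).inv ≫ T.cap ▷ T.X) ≫ (λ_ T.X).hom := by
        monoidal
    _ = _ := by
        unfold cup cap
        rw [h]; simp

theorem zigzag_left : 𝟙 T.X ⊗≫ T.cup ▷ T.X ⊗≫ T.X ◁ T.cap ⊗≫ 𝟙 T.X = 𝟙 T.X := by
  have h := T.selfDual.evaluation_coevaluation'
  calc _ = (λ_ T.X).inv ≫ (T.cup ▷ T.X ≫ (α_ _ _ _).hom ≫ T.X ◁ T.cap) ≫ (ρ_ T.X).hom := by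
        monoidal
    _ = _ := by
        unfold cup cap
        rw [h]; simp

/-- Bending back the right-most leg of a 3-box. -/
theorem bend_eq (f : T.X ⊗ T.X ⟶ T.X) :
    𝟙 _ ⊗≫ (T.X ⊗ T.X) ◁ T.cup ⊗≫ (𝟙 (T.X ⊗ T.X ⊗ T.X) ⊗≫ f ▷ T.X ⊗≫ T.cap) ▷ T.X ⊗≫ 𝟙 _ = f := by
  calc _ = 𝟙 _ ⊗≫ ((T.X ⊗ T.X) ◁ T.cup ≫ f ▷ (T.X ⊗ T.X)) ⊗≫ T.cap ▷ T.X ⊗≫ 𝟙 _ := by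
        monoidal
    _ = f ≫ (𝟙 T.X ⊗≫ T.X ◁ T.cup ⊗≫ T.cap ▷ T.X ⊗≫ 𝟙 T.X) := by
        rw [whisker_exchange]; monoidal
    _ = f := by rw [zigzag_right]; simp

theorem bend_split_eq (g : T.X ⟶ T.X ⊗ T.X) :
    𝟙 _ ⊗≫ T.X ◁ T.cup ⊗≫ (𝟙 (T.X ⊗ T.X) ⊗≫ g ▷ T.X ⊗≫ T.X ◁ T.cap ⊗≫ 𝟙 T.X) ▷ T.X ⊗≫ 𝟙 _ = g := by
  calc _ = 𝟙 _ ⊗≫ (T.X ◁ T.cup ≫ g ▷ (T.X ⊗ T.X)) ⊗≫ T.X ◁ T.cap ▷ T.X ⊗≫ 𝟙 _ := by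
        monoidal
    _ = g ≫ (𝟙 _ ⊗≫ T.X ◁ (𝟙 T.X ⊗≫ T.X ◁ T.cup ⊗≫ T.cap ▷ T.X ⊗≫ 𝟙 T.X) ⊗≫ 𝟙 _) := by
        rw [whisker_exchange]; monoidal
    _ = g := by rw [zigzag_right]; monoidal

theorem merge_eq_split_cap :
    𝟙 (T.X ⊗ T.X) ⊗≫ T.split ▷ T.X ⊗≫ T.X ◁ T.cap ⊗≫ 𝟙 T.X = T.merge := by
  calc _ = 𝟙 _ ⊗≫ T.X ◁ T.cup ▷ T.X ⊗≫ (T.merge ▷ (T.X ⊗ T.X) ≫ T.X ◁ T.cap) ⊗≫ 𝟙 _ := by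
        unfold split; monoidal
    _ = (𝟙 _ ⊗≫ T.X ◁ (𝟙 T.X ⊗≫ T.cup ▷ T.X ⊗≫ T.X ◁ T.cap ⊗≫ 𝟙 T.X) ⊗≫ 𝟙 _) ≫ T.merge := by
        rw [← whisker_exchange]; monoidal
    _ = _ := by rw [zigzag_left]; monoidal

/-- The vertex is invariant under rotation. -/
def RotationInvariant : Prop :=
  𝟙 T.X ⊗≫ T.cup ▷ T.X ⊗≫ T.X ◁ T.merge ⊗≫ 𝟙 (T.X ⊗ T.X) = T.split

variable {T}

theorem RotationInvariant.merge_eq_cap_split (h : T.RotationInvariant) :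
    𝟙 (T.X ⊗ T.X) ⊗≫ T.X ◁ T.split ⊗≫ T.cap ▷ T.X ⊗≫ 𝟙 T.X = T.merge := by
  calc _ = 𝟙 _ ⊗≫ T.X ◁ T.cup ▷ T.X ⊗≫ ((T.X ⊗ T.X) ◁ T.merge ≫ T.cap ▷ T.X) ⊗≫ 𝟙 _ := by
        rw [← h]; monoidal
    _ = (𝟙 _ ⊗≫ (𝟙 T.X ⊗≫ T.X ◁ T.cup ⊗≫ T.cap ▷ T.X ⊗≫ 𝟙 T.X) ▷ T.X ⊗≫ 𝟙 _) ≫ T.merge := by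
        rw [whisker_exchange]; monoidal
    _ = _ := by rw [zigzag_right]; monoidal

/-- The slope of the rung is immaterial: the bent leg of one vertex straightens into the other. -/
theorem RotationInvariant.diagH_eq (h : T.RotationInvariant) :
    𝟙 (T.X ⊗ T.X) ⊗≫ T.split ▷ T.X ⊗≫ T.X ◁ T.merge ⊗≫ 𝟙 (T.X ⊗ T.X) = T.diagH := by
  calc _ = 𝟙 _ ⊗≫ (T.split ▷ T.X ≫ (T.X ⊗ T.X) ◁ T.split) ⊗≫ T.X ◁ T.cap ▷ T.X ⊗≫ 𝟙 _ := by
        rw [← h.merge_eq_cap_split]; monoidal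
    _ = 𝟙 _ ⊗≫ T.X ◁ T.split ⊗≫
          (𝟙 (T.X ⊗ T.X) ⊗≫ T.split ▷ T.X ⊗≫ T.X ◁ T.cap ⊗≫ 𝟙 T.X) ▷ T.X ⊗≫ 𝟙 _ := by
        rw [← whisker_exchange]; monoidal
    _ = _ := by rw [merge_eq_split_cap]; rfl

theorem RotationInvariant.merge_cap (h : T.RotationInvariant) :
    𝟙 (T.X ⊗ T.X ⊗ T.X) ⊗≫ T.merge ▷ T.X ⊗≫ T.cap = 𝟙 (T.X ⊗ T.X ⊗ T.X) ⊗≫ T.X ◁ T.merge ⊗≫ T.cap := by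
  calc _ = 𝟙 _ ⊗≫ T.X ◁ T.split ▷ T.X ⊗≫ (T.cap ▷ (T.X ⊗ T.X) ≫ 𝟙_ C ◁ T.cap) ⊗≫ 𝟙 _ := by
        rw [← h.merge_eq_cap_split]; monoidal
    _ = 𝟙 _ ⊗≫ T.X ◁ (𝟙 (T.X ⊗ T.X) ⊗≫ T.split ▷ T.X ⊗≫ T.X ◁ T.cap ⊗≫ 𝟙 T.X) ⊗≫ T.cap := by
        rw [← whisker_exchange]; monoidal
    _ = _ := by rw [merge_eq_split_cap]

theorem RotationInvariant.cup_split (h : T.RotationInvariant) :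
    T.cup ⊗≫ T.X ◁ T.split = T.cup ⊗≫ T.split ▷ T.X ⊗≫ 𝟙 (T.X ⊗ T.X ⊗ T.X) := by
  calc _ = 𝟙 _ ⊗≫ (T.cup ▷ (𝟙_ C) ≫ (T.X ⊗ T.X) ◁ T.cup) ⊗≫ T.X ◁ T.merge ▷ T.X ⊗≫ 𝟙 _ := by
        unfold split; monoidal
    _ = T.cup ⊗≫ (𝟙 T.X ⊗≫ T.cup ▷ T.X ⊗≫ T.X ◁ T.merge ⊗≫ 𝟙 (T.X ⊗ T.X)) ▷ T.X ⊗≫ 𝟙 _ := by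
        rw [← whisker_exchange]; monoidal
    _ = _ := by rw [h]

/-- The one-click rotation of endomorphisms of `X ⊗ X`. -/
def rot (f : T.X ⊗ T.X ⟶ T.X ⊗ T.X) : T.X ⊗ T.X ⟶ T.X ⊗ T.X :=
  𝟙 _ ⊗≫ T.cup ▷ (T.X ⊗ T.X) ⊗≫ T.X ◁ f ▷ T.X ⊗≫ (T.X ⊗ T.X) ◁ T.cap ⊗≫ 𝟙 _

theorem rot_id : rot (𝟙 (T.X ⊗ T.X)) = T.cupCap := by
  calc _ = 𝟙 _ ⊗≫ (T.cup ▷ (T.X ⊗ T.X) ≫ (T.X ⊗ T.X) ◁ T.cap) ⊗≫ 𝟙 _ := by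
        unfold rot; monoidal
    _ = _ := by
        rw [← whisker_exchange]; unfold cupCap; monoidal

theorem rot_cupCap : rot T.cupCap = 𝟙 (T.X ⊗ T.X) := by
  calc _ = 𝟙 _ ⊗≫ (𝟙 T.X ⊗≫ T.cup ▷ T.X ⊗≫ T.X ◁ T.cap ⊗≫ 𝟙 T.X) ▷ T.X ⊗≫
        T.X ◁ (𝟙 T.X ⊗≫ T.cup ▷ T.X ⊗≫ T.X ◁ T.cap ⊗≫ 𝟙 T.X) ⊗≫ 𝟙 _ := by
        unfold rot cupCap; monoidal
    _ = _ := by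
        rw [zigzag_left]; monoidal

theorem RotationInvariant.rot_diagI (h : T.RotationInvariant) : rot T.diagI = T.diagH := by
  calc _ = 𝟙 _ ⊗≫ (𝟙 T.X ⊗≫ T.cup ▷ T.X ⊗≫ T.X ◁ T.merge ⊗≫ 𝟙 (T.X ⊗ T.X)) ▷ T.X ⊗≫
        T.X ◁ (𝟙 (T.X ⊗ T.X) ⊗≫ T.split ▷ T.X ⊗≫ T.X ◁ T.cap ⊗≫ 𝟙 T.X) ⊗≫ 𝟙 _ := by
        unfold rot diagI; monoidal
    _ = _ := by
        rw [h, merge_eq_split_cap, h.diagH_eq]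

theorem RotationInvariant.rot_diagH (h : T.RotationInvariant) : rot T.diagH = T.diagI := by
  calc _ = 𝟙 _ ⊗≫ (T.cup ▷ (T.X ⊗ T.X) ≫ (T.X ⊗ T.X) ◁ (T.split ▷ T.X)) ⊗≫
        (T.X ◁ T.merge ▷ (T.X ⊗ T.X) ⊗≫ (T.X ⊗ T.X) ◁ T.cap) ⊗≫ 𝟙 _ := by
        unfold rot diagH; monoidal
    _ = 𝟙 _ ⊗≫ T.split ▷ T.X ⊗≫ T.cup ▷ (T.X ⊗ T.X ⊗ T.X) ⊗≫
        ((T.X ◁ T.merge) ▷ (T.X ⊗ T.X) ≫ (T.X ⊗ T.X) ◁ T.cap) ⊗≫ 𝟙 _ := by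
        rw [← whisker_exchange]; monoidal
    _ = 𝟙 _ ⊗≫ T.split ▷ T.X ⊗≫ (T.cup ▷ (T.X ⊗ T.X ⊗ T.X) ≫
        (T.X ⊗ T.X) ◁ (T.X ◁ T.cap)) ⊗≫ T.X ◁ T.merge ⊗≫ 𝟙 _ := by
        rw [← whisker_exchange]; monoidal
    _ = (𝟙 (T.X ⊗ T.X) ⊗≫ T.split ▷ T.X ⊗≫ T.X ◁ T.cap ⊗≫ 𝟙 T.X) ≫
        (𝟙 T.X ⊗≫ T.cup ▷ T.X ⊗≫ T.X ◁ T.merge ⊗≫ 𝟙 (T.X ⊗ T.X)) := by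
        rw [← whisker_exchange]; monoidal
    _ = _ := by
        rw [h, merge_eq_split_cap]; rfl

theorem RotationInvariant.rot_square (h : T.RotationInvariant) : rot T.square = T.square := by
  calc _ = 𝟙 _ ⊗≫ (T.cup ▷ (T.X ⊗ T.X) ≫ (T.X ⊗ T.X) ◁ (T.split ▷ T.X)) ⊗≫
        T.X ◁ T.merge ▷ (T.X ⊗ T.X) ⊗≫ T.X ◁ T.split ▷ (T.X ⊗ T.X) ⊗≫
        (T.X ⊗ T.X) ◁ (𝟙 (T.X ⊗ T.X ⊗ T.X) ⊗≫ T.merge ▷ T.X ⊗≫ T.cap) ⊗≫ 𝟙 _ := by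
        unfold rot square
        -- The two rungs are drawn with opposite slopes, so that the cup and the cap of `rot` each
        -- meet a vertex that can be turned.
        nth_rw 2 [← h.diagH_eq]
        unfold diagH; monoidal
    _ = 𝟙 _ ⊗≫ T.split ▷ T.X ⊗≫ (𝟙 T.X ⊗≫ T.cup ▷ T.X ⊗≫ T.X ◁ T.merge ⊗≫ 𝟙 (T.X ⊗ T.X)) ▷ (T.X ⊗ T.X) ⊗≫
        T.X ◁ ((T.split ▷ (T.X ⊗ T.X)) ≫ ((T.X ⊗ T.X) ◁ T.merge)) ⊗≫
        (T.X ⊗ T.X) ◁ T.cap ⊗≫ 𝟙 _ := by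
        rw [← whisker_exchange, h.merge_cap]; monoidal
    _ = 𝟙 _ ⊗≫ T.split ▷ T.X ⊗≫ (T.split ▷ (T.X ⊗ T.X) ≫ (T.X ⊗ T.X) ◁ T.merge) ⊗≫
        T.X ◁ (𝟙 (T.X ⊗ T.X) ⊗≫ T.split ▷ T.X ⊗≫ T.X ◁ T.cap ⊗≫ 𝟙 T.X) ⊗≫ 𝟙 _ := by
        conv_lhs => rw [← whisker_exchange, h]
        monoidal
    _ = (𝟙 (T.X ⊗ T.X) ⊗≫ T.split ▷ T.X ⊗≫ T.X ◁ T.merge ⊗≫ 𝟙 (T.X ⊗ T.X)) ≫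
        (𝟙 (T.X ⊗ T.X) ⊗≫ T.split ▷ T.X ⊗≫ T.X ◁ T.merge ⊗≫ 𝟙 (T.X ⊗ T.X)) := by
        rw [← whisker_exchange, merge_eq_split_cap]; monoidal
    _ = _ := by rw [h.diagH_eq]; rfl

end PlanarCalculus

/-! ### Crossings and rotation. -/

section BraidedCalculus

variable {C : Type u} [Category.{w} C] [MonoidalCategory C] [BraidedCategory C]
  {T : TrivalentDatum C}

/-- By naturality a strand slides across the whole cup, which is two crossings; cancelling one of
them moves the other to the opposite leg with its sign changed. -/
theorem cup_posCrossing : 𝟙 T.X ⊗≫ T.cup ▷ T.X ⊗≫ T.X ◁ T.posCrossing ⊗≫ 𝟙 (T.X ⊗ T.X ⊗ T.X) =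
    𝟙 T.X ⊗≫ T.X ◁ T.cup ⊗≫ T.negCrossing ▷ T.X ⊗≫ 𝟙 (T.X ⊗ T.X ⊗ T.X) := by
  have h := BraidedCategory.braiding_naturality_left T.cup T.X
  rw [BraidedCategory.braiding_tensor_left_hom, braiding_tensorUnit_left] at h
  calc _ = 𝟙 _ ⊗≫ (T.cup ▷ T.X ≫ (α_ T.X T.X T.X).hom ≫ T.X ◁ (β_ T.X T.X).hom ≫ (α_ T.X T.X T.X).inv ≫
      (β_ T.X T.X).hom ▷ T.X ≫ (α_ T.X T.X T.X).hom) ⊗≫ T.negCrossing ▷ T.X ⊗≫ 𝟙 _ := by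
        simp [monoidalComp, posCrossing, negCrossing]
    _ = _ := by rw [h]; monoidal

theorem cup_negCrossing : 𝟙 T.X ⊗≫ T.cup ▷ T.X ⊗≫ T.X ◁ T.negCrossing ⊗≫ 𝟙 (T.X ⊗ T.X ⊗ T.X) =
    𝟙 T.X ⊗≫ T.X ◁ T.cup ⊗≫ T.posCrossing ▷ T.X ⊗≫ 𝟙 (T.X ⊗ T.X ⊗ T.X) := by
  have h := BraidedCategory.braiding_inv_naturality_left T.cup T.X
  rw [BraidedCategory.braiding_tensor_right_inv, braiding_inv_tensorUnit_right] at h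
  calc _ = 𝟙 _ ⊗≫ (T.cup ▷ T.X ≫ (α_ T.X T.X T.X).hom ≫ T.X ◁ (β_ T.X T.X).inv ≫
      (α_ T.X T.X T.X).inv ≫ (β_ T.X T.X).inv ▷ T.X ≫ (α_ T.X T.X T.X).hom) ⊗≫
        T.posCrossing ▷ T.X ⊗≫ 𝟙 _ := by
        simp [monoidalComp, posCrossing, negCrossing]
    _ = _ := by rw [h]; monoidal

theorem rot_posCrossing : rot T.posCrossing = T.negCrossing := by
  calc _ = 𝟙 _ ⊗≫ (𝟙 T.X ⊗≫ T.cup ▷ T.X ⊗≫ T.X ◁ T.posCrossing ⊗≫ 𝟙 (T.X ⊗ T.X ⊗ T.X)) ▷ T.X ⊗≫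
        (T.X ⊗ T.X) ◁ T.cap ⊗≫ 𝟙 _ := by
        unfold rot; monoidal
    _ = 𝟙 _ ⊗≫ T.X ◁ T.cup ▷ T.X ⊗≫ (T.negCrossing ▷ (T.X ⊗ T.X) ≫ (T.X ⊗ T.X) ◁ T.cap) ⊗≫
        𝟙 _ := by
        rw [cup_posCrossing]; monoidal
    _ = 𝟙 _ ⊗≫ T.X ◁ (𝟙 T.X ⊗≫ T.cup ▷ T.X ⊗≫ T.X ◁ T.cap ⊗≫ 𝟙 T.X) ⊗≫ T.negCrossing := by
        rw [← whisker_exchange]; monoidal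
    _ = _ := by rw [zigzag_left]; monoidal

theorem rot_negCrossing : rot T.negCrossing = T.posCrossing := by
  calc _ = 𝟙 _ ⊗≫ (𝟙 T.X ⊗≫ T.cup ▷ T.X ⊗≫ T.X ◁ T.negCrossing ⊗≫ 𝟙 (T.X ⊗ T.X ⊗ T.X)) ▷ T.X ⊗≫
        (T.X ⊗ T.X) ◁ T.cap ⊗≫ 𝟙 _ := by
        unfold rot; monoidal
    _ = 𝟙 _ ⊗≫ T.X ◁ T.cup ▷ T.X ⊗≫ (T.posCrossing ▷ (T.X ⊗ T.X) ≫ (T.X ⊗ T.X) ◁ T.cap) ⊗≫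
        𝟙 _ := by
        rw [cup_negCrossing]; monoidal
    _ = 𝟙 _ ⊗≫ T.X ◁ (𝟙 T.X ⊗≫ T.cup ▷ T.X ⊗≫ T.X ◁ T.cap ⊗≫ 𝟙 T.X) ⊗≫ T.posCrossing := by
        rw [← whisker_exchange]; monoidal
    _ = _ := by rw [zigzag_left]; monoidal

theorem merge_braiding : 𝟙 ((T.X ⊗ T.X) ⊗ T.X) ⊗≫ T.merge ▷ T.X ⊗≫ T.posCrossing =
    𝟙 ((T.X ⊗ T.X) ⊗ T.X) ⊗≫ T.X ◁ T.posCrossing ⊗≫ T.posCrossing ▷ T.X ⊗≫ T.X ◁ T.merge := by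
  have h := BraidedCategory.braiding_naturality_left T.merge T.X
  rw [BraidedCategory.braiding_tensor_left_hom] at h
  calc _ = 𝟙 _ ⊗≫ (T.merge ▷ T.X ≫ (β_ T.X T.X).hom) := by
        simp [monoidalComp, posCrossing]
    _ = _ := by rw [h]; simp [monoidalComp, posCrossing]

end BraidedCalculus

end TrivalentDatum

/-! ### Linearity, and the passage from `End(X ⊗ X)` to the 4-box space. -/

namespace TrivalentDatum

section LinearCalculus

variable {C : Type u} [Category.{w} C] [Preadditive C] [Linear ℂ C]
  [MonoidalCategory C] [MonoidalPreadditive C] [MonoidalLinear ℂ C] {T : TrivalentDatum C}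

/-- Rotation as a linear map. -/
def rotₗ : (T.X ⊗ T.X ⟶ T.X ⊗ T.X) →ₗ[ℂ] (T.X ⊗ T.X ⟶ T.X ⊗ T.X) where
  toFun := rot
  map_add' f g := by
    simp [rot, monoidalComp, MonoidalPreadditive.whiskerLeft_add,
      MonoidalPreadditive.add_whiskerRight]
  map_smul' c f := by
    simp [rot, monoidalComp]

/-- Bending both upper legs of an endomorphism of `X ⊗ X` down. -/
def bendDown : (T.X ⊗ T.X ⟶ T.X ⊗ T.X) →ₗ[ℂ] (T.X ⊗ T.X ⊗ T.X ⊗ T.X ⟶ 𝟙_ C) where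
  toFun f := 𝟙 _ ⊗≫ f ▷ (T.X ⊗ T.X) ⊗≫ T.X ◁ T.cap ▷ T.X ⊗≫ T.cap
  map_add' f g := by
    simp [monoidalComp, MonoidalPreadditive.add_whiskerRight]
  map_smul' c f := by
    simp [monoidalComp]

/-- Transports the bound on `dim C(4)` to `End(X ⊗ X)`. The left inverse bends the legs back up with
two nested cups. -/
theorem bendDown_injective : Function.Injective (bendDown (T := T)) := by
  refine Function.LeftInverse.injective
    (g := fun k => 𝟙 _ ⊗≫ (T.X ⊗ T.X) ◁ T.cup ⊗≫ (T.X ⊗ T.X ⊗ T.X) ◁ T.cup ▷ T.X ⊗≫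
      k ▷ (T.X ⊗ T.X) ⊗≫ 𝟙 _) fun f => ?_
  change 𝟙 _ ⊗≫ (T.X ⊗ T.X) ◁ T.cup ⊗≫ (T.X ⊗ T.X ⊗ T.X) ◁ T.cup ▷ T.X ⊗≫
      (𝟙 _ ⊗≫ f ▷ (T.X ⊗ T.X) ⊗≫ T.X ◁ T.cap ▷ T.X ⊗≫ T.cap) ▷ (T.X ⊗ T.X) ⊗≫ 𝟙 _ = f
  calc _ = 𝟙 _ ⊗≫ ((T.X ⊗ T.X) ◁ (𝟙 (𝟙_ C) ⊗≫ T.cup ⊗≫ T.X ◁ T.cup ▷ T.X ⊗≫ 𝟙 (T.X ⊗ T.X ⊗ T.X ⊗ T.X)) ≫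
        f ▷ (T.X ⊗ T.X ⊗ T.X ⊗ T.X)) ⊗≫
        T.X ◁ T.cap ▷ (T.X ⊗ T.X ⊗ T.X) ⊗≫ T.cap ▷ (T.X ⊗ T.X) ⊗≫ 𝟙 _ := by
        monoidal
    _ = f ⊗≫ T.X ◁ (T.X ◁ T.cup ⊗≫ (T.X ⊗ T.X) ◁ T.cup ▷ T.X ⊗≫
        T.cap ▷ (T.X ⊗ T.X ⊗ T.X) ⊗≫ 𝟙 (T.X ⊗ T.X ⊗ T.X)) ⊗≫ T.cap ▷ (T.X ⊗ T.X) ⊗≫ 𝟙 _ := by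
        rw [whisker_exchange]; monoidal
    _ = f ⊗≫ T.X ◁ (T.X ◁ T.cup ⊗≫ ((T.X ⊗ T.X) ◁ (T.cup ▷ T.X) ≫
        T.cap ▷ ((T.X ⊗ T.X) ⊗ T.X)) ⊗≫ 𝟙 (T.X ⊗ T.X ⊗ T.X)) ⊗≫ T.cap ▷ (T.X ⊗ T.X) ⊗≫ 𝟙 _ := by
        monoidal
    _ = f ⊗≫ T.X ◁ ((𝟙 T.X ⊗≫ T.X ◁ T.cup ⊗≫ T.cap ▷ T.X ⊗≫ 𝟙 T.X) ⊗≫ T.cup ▷ T.X ⊗≫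
        𝟙 (T.X ⊗ T.X ⊗ T.X)) ⊗≫ T.cap ▷ (T.X ⊗ T.X) ⊗≫ 𝟙 _ := by
        rw [whisker_exchange]; monoidal
    _ = f ⊗≫ (𝟙 T.X ⊗≫ T.X ◁ T.cup ⊗≫ T.cap ▷ T.X ⊗≫ 𝟙 T.X) ▷ T.X := by
        conv_lhs => rw [zigzag_right]
        monoidal
    _ = f := by rw [zigzag_right]; monoidal

end LinearCalculus

end TrivalentDatum

/-! ### Consequences of the small box spaces. -/

namespace TrivalentRibbon

open TrivalentDatum

variable {C : Type u} [Category.{w} C] [Preadditive C] [Linear ℂ C]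
  [MonoidalCategory C] [MonoidalPreadditive C] [MonoidalLinear ℂ C] [BraidedCategory C]
  [RigidCategory C] [RibbonCategory C] (T : TrivalentRibbon C)

theorem id_unit_ne_zero (T : TrivalentRibbon C) : 𝟙 (𝟙_ C) ≠ 0 := by
  intro h
  obtain ⟨c, -, hc⟩ := T.box_zero (𝟙 (𝟙_ C))
  have h0 := hc 0 (by simp [h])
  have h1 := hc 1 (by simp)
  exact zero_ne_one (h0.trans h1.symm)

theorem cup_ne_zero : T.cup ≠ 0 := by
  intro h
  have := T.circle_eq
  rw [circle, h, Limits.zero_comp, eq_comm, smul_eq_zero] at this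
  exact this.elim T.d_ne_zero T.id_unit_ne_zero

theorem id_strand_ne_zero : 𝟙 T.X ≠ 0 := by
  intro h
  apply T.cup_ne_zero
  have : T.cup = T.cup ≫ T.X ◁ 𝟙 T.X := by simp
  rw [this, h]; simp

theorem merge_ne_zero : T.merge ≠ 0 := by
  intro h
  have := T.bigon_eq
  rw [bigon, h, Limits.comp_zero, eq_comm, smul_eq_zero] at this
  exact this.elim T.b_ne_zero T.id_strand_ne_zero

theorem exists_eq_smul_merge (f : T.X ⊗ T.X ⟶ T.X) : ∃ c : ℂ, f = c • T.merge := by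
  obtain ⟨c, hc, -⟩ := T.box_three (𝟙 (T.X ⊗ T.X ⊗ T.X) ⊗≫ f ▷ T.X ⊗≫ T.cap)
  refine ⟨c, ?_⟩
  rw [← T.bend_eq f, hc]
  simp [merge, monoidalComp]

theorem exists_eq_smul_split (g : T.X ⟶ T.X ⊗ T.X) : ∃ c : ℂ, g = c • T.split := by
  obtain ⟨c, hc⟩ := T.exists_eq_smul_merge
    (𝟙 (T.X ⊗ T.X) ⊗≫ g ▷ T.X ⊗≫ T.X ◁ T.cap ⊗≫ 𝟙 T.X)
  refine ⟨c, ?_⟩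
  rw [← T.bend_split_eq g, hc]
  simp [split, monoidalComp]

theorem eq_zero_of_unit_to_strand (g : 𝟙_ C ⟶ T.X) : g = 0 := by
  have h := T.box_one (𝟙 T.X ⊗≫ g ▷ T.X ⊗≫ T.cap)
  calc g = 𝟙 _ ⊗≫ g ▷ 𝟙_ C ⊗≫ (𝟙 T.X ⊗≫ T.X ◁ T.cup ⊗≫ T.cap ▷ T.X ⊗≫ 𝟙 T.X) ⊗≫ 𝟙 _ := by
        rw [T.zigzag_right]; monoidal
    _ = 𝟙 _ ⊗≫ (g ▷ 𝟙_ C ≫ T.X ◁ T.cup) ⊗≫ T.cap ▷ T.X ⊗≫ 𝟙 _ := by monoidal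
    _ = 𝟙 _ ⊗≫ T.cup ⊗≫ (𝟙 T.X ⊗≫ g ▷ T.X ⊗≫ T.cap) ▷ T.X ⊗≫ 𝟙 _ := by
        rw [← whisker_exchange]; monoidal
    _ = 0 := by rw [h]; simp [monoidalComp]

theorem cup_merge : T.cup ≫ T.merge = 0 := T.eq_zero_of_unit_to_strand _

theorem neg_pos : T.negCrossing ≫ T.posCrossing = 𝟙 _ := by simp [negCrossing, posCrossing]

theorem pos_neg : T.posCrossing ≫ T.negCrossing = 𝟙 _ := by simp [negCrossing, posCrossing]

variable {T} {a : ℂ}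

theorem cup_posCrossing_eq (ha : a ≠ 0) (h : T.cup ≫ T.negCrossing = a ^ 2 • T.cup) :
    T.cup ≫ T.posCrossing = (a ^ 2)⁻¹ • T.cup := by
  have := congrArg (· ≫ T.posCrossing) h
  simp only [Category.assoc, neg_pos, Category.comp_id, Linear.smul_comp] at this
  rw [eq_inv_smul_iff₀ (pow_ne_zero 2 ha), ← this]

theorem posCrossing_merge_eq (ha : a ≠ 0) (h : T.negCrossing ≫ T.merge = (-a) • T.merge) :
    T.posCrossing ≫ T.merge = (-a⁻¹) • T.merge := by
  have := congrArg (T.posCrossing ≫ ·) h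
  simp only [← Category.assoc, pos_neg, Category.id_comp, Linear.comp_smul] at this
  rw [neg_smul, ← smul_neg, eq_inv_smul_iff₀ ha, eq_comm, neg_eq_iff_eq_neg, ← neg_smul, ← this]

/-- `Hom(X, X ⊗ X)` is spanned by `split`, so some eigenvalue exists; closing up to a bigon, with `b
≠ 0`, identifies it with the one for `merge`. -/
theorem split_posCrossing_eq (ha : a ≠ 0) (h : T.negCrossing ≫ T.merge = (-a) • T.merge) :
    T.split ≫ T.posCrossing = (-a⁻¹) • T.split := by
  obtain ⟨c, hc⟩ := T.exists_eq_smul_split (T.split ≫ T.posCrossing)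
  have h1 := congrArg (· ≫ T.merge) hc
  have hb := T.bigon_eq
  rw [bigon] at hb
  simp only [Category.assoc, posCrossing_merge_eq ha h, Linear.smul_comp, Linear.comp_smul, hb,
    smul_smul] at h1
  rw [hc, mul_right_cancel₀ T.b_ne_zero (smul_left_injective ℂ T.id_strand_ne_zero h1)]

/-- Sliding the vertex through the crossing turns `split ≫ posCrossing` into the rotated vertex
times `a⁻² · (-a)`. This equals the eigenvalue `-a⁻¹` on `split` precisely because the cup twist is
the square of the vertex twist. -/
theorem rotationInvariant (ha : a ≠ 0) (h₁ : T.cup ≫ T.negCrossing = a ^ 2 • T.cup)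
    (h₂ : T.negCrossing ≫ T.merge = (-a) • T.merge) : T.RotationInvariant := by
  have key : T.split ≫ T.posCrossing = (-a⁻¹) •
      (𝟙 T.X ⊗≫ T.cup ▷ T.X ⊗≫ T.X ◁ T.merge ⊗≫ 𝟙 (T.X ⊗ T.X)) := by
    calc _ = 𝟙 _ ⊗≫ T.X ◁ T.cup ⊗≫
          (𝟙 ((T.X ⊗ T.X) ⊗ T.X) ⊗≫ T.merge ▷ T.X ⊗≫ T.posCrossing) := by
          unfold split; monoidal
      _ = 𝟙 _ ⊗≫ T.X ◁ (T.cup ≫ T.posCrossing) ⊗≫ T.posCrossing ▷ T.X ⊗≫ T.X ◁ T.merge := by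
          rw [merge_braiding]; monoidal
      _ = (a ^ 2)⁻¹ • (𝟙 _ ⊗≫ T.X ◁ T.cup ⊗≫ T.posCrossing ▷ T.X ⊗≫ T.X ◁ T.merge) := by
          rw [cup_posCrossing_eq ha h₁]; simp [monoidalComp]
      _ = (a ^ 2)⁻¹ • ((𝟙 T.X ⊗≫ T.X ◁ T.cup ⊗≫ T.posCrossing ▷ T.X ⊗≫ 𝟙 (T.X ⊗ T.X ⊗ T.X)) ⊗≫
          T.X ◁ T.merge) := by
          congr 1; monoidal
      _ = (a ^ 2)⁻¹ • (𝟙 _ ⊗≫ T.cup ▷ T.X ⊗≫ T.X ◁ (T.negCrossing ≫ T.merge) ⊗≫ 𝟙 _) := by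
          rw [← cup_negCrossing]; congr 1; monoidal
      _ = _ := by
          rw [h₂]
          simp only [MonoidalLinear.whiskerLeft_smul, monoidalComp, Linear.smul_comp,
            Linear.comp_smul, smul_smul]
          congr 1
          field_simp
  rw [split_posCrossing_eq ha h₂] at key
  exact (smul_right_injective _ (neg_ne_zero.mpr (inv_ne_zero ha)) key).symm

theorem cup_diagH (h : T.RotationInvariant) : T.cup ≫ T.diagH = T.b • T.cup := by
  have hb := T.bigon_eq
  rw [bigon] at hb
  calc _ = (T.cup ⊗≫ T.X ◁ T.split) ⊗≫ T.merge ▷ T.X ⊗≫ 𝟙 _ := by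
        unfold diagH; monoidal
    _ = T.cup ≫ (T.split ≫ T.merge) ▷ T.X := by
        rw [h.cup_split]; monoidal
    _ = _ := by rw [hb]; simp

theorem diagH_cap (h : T.RotationInvariant) : T.diagH ≫ T.cap = T.b • T.cap := by
  have hb := T.bigon_eq
  rw [bigon] at hb
  calc _ = 𝟙 _ ⊗≫ T.X ◁ T.split ⊗≫ (𝟙 (T.X ⊗ T.X ⊗ T.X) ⊗≫ T.merge ▷ T.X ⊗≫ T.cap) := by
        unfold diagH; monoidal
    _ = T.X ◁ (T.split ≫ T.merge) ≫ T.cap := by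
        rw [h.merge_cap]; monoidal
    _ = _ := by rw [hb]; simp

theorem exists_relation (hdim : Module.rank ℂ (T.X ⊗ T.X ⊗ T.X ⊗ T.X ⟶ 𝟙_ C) ≤ 5)
    (x : Fin 6 → (T.X ⊗ T.X ⟶ T.X ⊗ T.X)) : ∃ g : Fin 6 → ℂ, ∑ i, g i • x i = 0 ∧ g ≠ 0 := by
  by_contra! hcon
  have hx : LinearIndependent ℂ x := Fintype.linearIndependent_iff.mpr fun g hg i =>
    congrFun (hcon g hg) i
  have h1 := hx.cardinal_lift_le_rank
  have h2 := LinearMap.rank_le_of_injective _ (bendDown_injective (T := T.toTrivalentDatum))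
  have h3 := h2.trans hdim
  simp only [Cardinal.mk_fin, Cardinal.lift_natCast] at h1
  have h4 : ((6 : ℕ) : Cardinal) ≤ ((5 : ℕ) : Cardinal) := by
    have := h1.trans (Cardinal.lift_le.mpr h3)
    simpa using this
  exact absurd (Nat.cast_le.mp h4) (by norm_num)

end TrivalentRibbon

/-! ### Calculus of relations among the six diagrams. -/

namespace TrivalentRibbon

open TrivalentDatum

variable {C : Type u} [Category.{w} C] [Preadditive C] [Linear ℂ C]
  [MonoidalCategory C] [MonoidalPreadditive C] [MonoidalLinear ℂ C] [BraidedCategory C]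
  [RigidCategory C] [RibbonCategory C] (T : TrivalentRibbon C)

/-- Linear combinations of the diagrams with at most one crossing or two vertices. -/
def comb (p q r s m n : ℂ) : T.X ⊗ T.X ⟶ T.X ⊗ T.X :=
  p • 𝟙 (T.X ⊗ T.X) + q • T.cupCap + r • T.diagI + s • T.diagH + m • T.negCrossing
    + n • T.posCrossing

variable {T} {v α t : ℂ}

theorem comb_add (p q r s m n p' q' r' s' m' n' : ℂ) :
    T.comb p q r s m n + T.comb p' q' r' s' m' n' =
      T.comb (p + p') (q + q') (r + r') (s + s') (m + m') (n + n') := by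
  unfold comb; module

theorem comb_sub (p q r s m n p' q' r' s' m' n' : ℂ) :
    T.comb p q r s m n - T.comb p' q' r' s' m' n' =
      T.comb (p - p') (q - q') (r - r') (s - s') (m - m') (n - n') := by
  unfold comb; module

theorem smul_comb (k p q r s m n : ℂ) :
    k • T.comb p q r s m n = T.comb (k * p) (k * q) (k * r) (k * s) (k * m) (k * n) := by
  unfold comb; module

theorem rot_comb (hR : T.RotationInvariant) (p q r s m n : ℂ) :
    rotₗ (T.comb p q r s m n) = T.comb q p s r n m := by
  have h : ∀ f : T.X ⊗ T.X ⟶ T.X ⊗ T.X, rotₗ f = rot f := fun _ => rfl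
  simp only [comb, map_add, map_smul]
  simp only [h, rot_id, rot_cupCap, hR.rot_diagI, hR.rot_diagH,
    rot_negCrossing, rot_posCrossing]
  module

theorem comb_rot_eq_zero (hR : T.RotationInvariant) {p q r s m n : ℂ}
    (h : T.comb p q r s m n = 0) : T.comb q p s r n m = 0 := by
  rw [← rot_comb hR, h, map_zero]

theorem comb_sub_rot_eq_zero (hR : T.RotationInvariant) {p q r s m n : ℂ}
    (h : T.comb p q r s m n = 0) :
    T.comb (p - q) (-(p - q)) (r - s) (-(r - s)) (m - n) (-(m - n)) = 0 := by
  have := comb_sub (T := T) p q r s m n q p s r n m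
  rw [h, comb_rot_eq_zero hR h, sub_zero] at this
  rw [this]
  congr 1 <;> ring

theorem QEJac.rotationInvariant (hJ : T.QEJac v α) (hv : v ≠ 0) : T.RotationInvariant :=
  TrivalentRibbon.rotationInvariant (a := v ^ 6) (pow_ne_zero 6 hv)
    (by rw [hJ.twist_eq]; congr 1; ring) hJ.twist_vertex_eq

theorem QEJac.cup_posCrossing (hJ : T.QEJac v α) (hv : v ≠ 0) :
    T.cup ≫ T.posCrossing = (v ^ 12)⁻¹ • T.cup := by
  rw [cup_posCrossing_eq (a := v ^ 6) (pow_ne_zero 6 hv) (by rw [hJ.twist_eq]; congr 1; ring)]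
  congr 2; ring

theorem QEJac.posCrossing_merge (hJ : T.QEJac v α) (hv : v ≠ 0) :
    T.posCrossing ≫ T.merge = (-(v ^ 6)⁻¹) • T.merge :=
  posCrossing_merge_eq (pow_ne_zero 6 hv) hJ.twist_vertex_eq

theorem QEJac.split_posCrossing (hJ : T.QEJac v α) (hv : v ≠ 0) :
    T.split ≫ T.posCrossing = (-(v ^ 6)⁻¹) • T.split :=
  split_posCrossing_eq (pow_ne_zero 6 hv) hJ.twist_vertex_eq

theorem QEJac.split_negCrossing (hJ : T.QEJac v α) (hv : v ≠ 0) :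
    T.split ≫ T.negCrossing = (-v ^ 6) • T.split := by
  have := congrArg (· ≫ T.negCrossing) (hJ.split_posCrossing hv)
  simp only [Category.assoc, pos_neg, Category.comp_id, Linear.smul_comp] at this
  conv_rhs => rw [this]
  rw [smul_smul]
  have : -v ^ 6 * -(v ^ 6)⁻¹ = 1 := by field_simp
  rw [this, one_smul]

theorem QEJac.cup_comb (hJ : T.QEJac v α) (hv : v ≠ 0) (p q r s m n : ℂ) :
    T.cup ≫ T.comb p q r s m n =
      (p + q * T.d + s * T.b + m * v ^ 12 + n * (v ^ 12)⁻¹) • T.cup := by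
  have h1 : T.cup ≫ T.cupCap = T.d • T.cup := by
    have := T.circle_eq
    rw [circle] at this
    rw [cupCap, ← Category.assoc, this]; simp
  have h2 : T.cup ≫ T.diagI = 0 := by
    rw [diagI, ← Category.assoc, T.cup_merge, Limits.zero_comp]
  simp only [comb, Preadditive.comp_add, Linear.comp_smul, h1, h2,
    cup_diagH (hJ.rotationInvariant hv), hJ.twist_eq, hJ.cup_posCrossing hv, Category.comp_id]
  module

theorem QEJac.comb_merge (hJ : T.QEJac v α) (hv : v ≠ 0) (ht : T.triangle = t • T.merge)
    (p q r s m n : ℂ) :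
    T.comb p q r s m n ≫ T.merge =
      (p + r * T.b + s * t - m * v ^ 6 - n * (v ^ 6)⁻¹) • T.merge := by
  have h1 : T.cupCap ≫ T.merge = 0 := by
    rw [cupCap, Category.assoc, T.cup_merge, Limits.comp_zero]
  have h2 : T.diagI ≫ T.merge = T.b • T.merge := by
    have := T.bigon_eq
    rw [bigon] at this
    rw [diagI, Category.assoc, this]; simp
  rw [TrivalentDatum.triangle] at ht
  simp only [comb, Preadditive.add_comp, Linear.smul_comp, h1, h2, ht,
    hJ.twist_vertex_eq, hJ.posCrossing_merge hv, Category.id_comp]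
  module

/-- The cup is a common eigenvector of the six diagrams, with eigenvalue zero for `I`, so a relation
becomes a scalar equation. `merge_eq` does the same with `Y`, which kills `U`. -/
theorem QEJac.cap_eq (hJ : T.QEJac v α) (hv : v ≠ 0) {p q r s m n : ℂ}
    (h : T.comb p q r s m n = 0) :
    p + q * T.d + s * T.b + m * v ^ 12 + n * (v ^ 12)⁻¹ = 0 := by
  have := hJ.cup_comb hv p q r s m n
  rw [h, Limits.comp_zero, eq_comm, smul_eq_zero] at this
  exact this.resolve_right T.cup_ne_zero

theorem QEJac.merge_eq (hJ : T.QEJac v α) (hv : v ≠ 0) (ht : T.triangle = t • T.merge)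
    {p q r s m n : ℂ} (h : T.comb p q r s m n = 0) :
    p + r * T.b + s * t - m * v ^ 6 - n * (v ^ 6)⁻¹ = 0 := by
  have := hJ.comb_merge hv ht p q r s m n
  rw [h, Limits.zero_comp, eq_comm, smul_eq_zero] at this
  exact this.resolve_right T.merge_ne_zero

/-- The Jacobi relation, solved for the third tree. -/
theorem QEJac.diagX_eq (hJ : T.QEJac v α) (hv : v ≠ 0) :
    T.diagH ≫ T.negCrossing =
      T.comb (-α * v⁻¹) (-α * v ^ 7) (-v ^ 4) (v ^ 2) (-α * v ^ 3) 0 := by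
  have h := congrArg (v ^ 3 • ·) hJ.jacobi_eq
  simp only [smul_zero, diagX] at h
  rw [← sub_eq_zero, ← h, comb]
  simp only [zpow_neg, zpow_ofNat]
  match_scalars <;> (field_simp; try ring)

/-- The Jacobi relation with positive crossings. -/
theorem QEJac.diagH_posCrossing (hJ : T.QEJac v α) (hv : v ≠ 0) :
    T.diagH ≫ T.posCrossing =
      T.comb (α * v) (α * (v ^ 7)⁻¹) (-(v ^ 4)⁻¹) ((v ^ 2)⁻¹) 0 (α * (v ^ 3)⁻¹) := by
  -- On the left the crossings cancel and leave `H`; on the right `H` followed by the positive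
  -- crossing has coefficient `v ^ 2`, so the equation can be solved for it.
  have h := congrArg (fun f => v⁻¹ ^ 2 • (f ≫ T.posCrossing)) (hJ.diagX_eq hv)
  have h1 : T.diagI ≫ T.posCrossing = (-(v ^ 6)⁻¹) • T.diagI := by
    rw [diagI, Category.assoc, hJ.split_posCrossing hv, Linear.comp_smul]
  have h2 : T.cupCap ≫ T.posCrossing = (v ^ 12)⁻¹ • T.cupCap := by
    rw [cupCap, Category.assoc, hJ.cup_posCrossing hv, Linear.comp_smul]
  simp only [comb, Preadditive.add_comp, Linear.smul_comp, h1, h2, Category.assoc, neg_pos,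
    Category.comp_id, Category.id_comp] at h
  rw [← sub_eq_zero] at h ⊢
  rw [← neg_eq_zero, ← h, comb]
  match_scalars <;> (field_simp; try ring)

theorem QEJac.diagH_comb (hJ : T.QEJac v α) (hv : v ≠ 0) (ht : T.triangle = t • T.merge)
    (p q r s m n : ℂ) :
    T.diagH ≫ T.comb p q r s m n = s • T.square +
      T.comb (-m * α * v⁻¹ + n * α * v) (q * T.b - m * α * v ^ 7 + n * α * (v ^ 7)⁻¹)
        (r * t - m * v ^ 4 - n * (v ^ 4)⁻¹) (p + m * v ^ 2 + n * (v ^ 2)⁻¹)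
        (-m * α * v ^ 3) (n * α * (v ^ 3)⁻¹) := by
  have h1 : T.diagH ≫ T.cupCap = T.b • T.cupCap := by
    rw [cupCap, ← Category.assoc, diagH_cap (hJ.rotationInvariant hv), Linear.smul_comp]
  have h2 : T.diagH ≫ T.diagI = t • T.diagI := by
    rw [TrivalentDatum.triangle] at ht
    rw [diagI, ← Category.assoc, ht, Linear.smul_comp]
  conv_lhs => rw [comb]
  simp only [Preadditive.comp_add, Linear.comp_smul, h1, h2, hJ.diagX_eq hv,
    hJ.diagH_posCrossing hv, Category.comp_id]
  simp only [comb, square]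
  module

/-- Precompose with `H`, then subtract the rotation: the multiple of the square cancels because the
square is rotation invariant. The value of `B` stays unspecified since closing with the cup or `Y`
recovers it where needed. -/
theorem QEJac.derived_relation (hJ : T.QEJac v α) (hv : v ≠ 0) (ht : T.triangle = t • T.merge)
    {p q r s m n : ℂ} (h : T.comb p q r s m n = 0) :
    ∃ B : ℂ, T.comb (-m * α * v⁻¹ + n * α * v - (q * T.b - m * α * v ^ 7 + n * α * (v ^ 7)⁻¹))
      (-(-m * α * v⁻¹ + n * α * v - (q * T.b - m * α * v ^ 7 + n * α * (v ^ 7)⁻¹)))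
      B (-B) (-α * (m * v ^ 3 + n * (v ^ 3)⁻¹)) (-(-α * (m * v ^ 3 + n * (v ^ 3)⁻¹))) = 0 := by
  have hR := hJ.rotationInvariant hv
  have h1 := hJ.diagH_comb hv ht p q r s m n
  rw [h, Limits.comp_zero] at h1
  have hS : rotₗ T.square = T.square := hR.rot_square
  have h2 := congrArg rotₗ h1
  rw [map_zero, map_add, map_smul, hS, rot_comb hR] at h2
  have h3 := congrArg₂ (· - ·) h1.symm h2.symm
  simp only [add_sub_add_left_eq_sub, sub_zero, comb_sub] at h3
  refine ⟨r * t - m * v ^ 4 - n * (v ^ 4)⁻¹ - (p + m * v ^ 2 + n * (v ^ 2)⁻¹), Eq.trans ?_ h3⟩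
  congr 1 <;> first | rfl | ring

theorem QEJac.circle_value (hJ : T.QEJac v α) (hv : v ≠ 0) :
    (v ^ 10 - 1) * v ^ 3 * T.b + α * (v ^ 16 + v ^ 8 * T.d + 1) = 0 := by
  have h := congrArg (T.cup ≫ ·) (hJ.diagX_eq hv)
  simp only [hJ.cup_comb hv, ← Category.assoc, cup_diagH (hJ.rotationInvariant hv),
    Linear.smul_comp, hJ.twist_eq, smul_smul] at h
  have := smul_left_injective ℂ T.cup_ne_zero h
  field_simp at this
  apply mul_left_cancel₀ (pow_ne_zero 11 hv)
  linear_combination this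

theorem QEJac.triangle_value (hJ : T.QEJac v α) (hv : v ≠ 0) (ht : T.triangle = t • T.merge) :
    v ^ 3 * (v ^ 4 + 1) * t = v ^ 5 * T.b - α * (v ^ 10 - 1) := by
  have h := congrArg (· ≫ T.merge) (hJ.diagX_eq hv)
  have ht' := ht
  rw [TrivalentDatum.triangle] at ht'
  simp only [hJ.comb_merge hv ht, Category.assoc, hJ.twist_vertex_eq, Linear.comp_smul, ht',
    smul_smul] at h
  have := smul_left_injective ℂ T.merge_ne_zero h
  field_simp at this
  apply mul_left_cancel₀ (pow_ne_zero 5 hv)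
  linear_combination (-1) * this

end TrivalentRibbon

/-! ### Nondegeneracy, and the crossing and square relations. -/

namespace TrivalentRibbon

open TrivalentDatum

variable {C : Type u} [Category.{w} C] [Preadditive C] [Linear ℂ C]
  [MonoidalCategory C] [MonoidalPreadditive C] [MonoidalLinear ℂ C] [BraidedCategory C]
  [RigidCategory C] [RibbonCategory C] {T : TrivalentRibbon C} {v α t : ℂ}

theorem QEJac.alpha_ne_zero (hJ : T.QEJac v α) (hv : v ≠ 0) (hv10 : v ^ 10 ≠ 1) : α ≠ 0 := by
  rintro rfl
  have h := hJ.circle_value hv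
  simp only [zero_mul, add_zero, mul_eq_zero, T.b_ne_zero, or_false, pow_eq_zero_iff, ne_eq,
    OfNat.ofNat_ne_zero, not_false_eq_true, hv] at h
  exact hv10 (sub_eq_zero.mp h)

/-- If `v ^ 4 = -1`, the triangle equation loses `t` and fixes `b` in terms of `α`; the circle
equation then reads `α d = 0`. -/
theorem QEJac.pow_four_ne_neg_one (hJ : T.QEJac v α) (hv : v ≠ 0) (hv10 : v ^ 10 ≠ 1) :
    v ^ 4 + 1 ≠ 0 := by
  intro h4
  obtain ⟨t, ht⟩ := T.exists_eq_smul_merge T.triangle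
  have h := hJ.triangle_value hv ht
  have hd := hJ.circle_value hv
  have hα := hJ.alpha_ne_zero hv hv10
  have hvb : v * T.b + α * (v ^ 2 - 1) = 0 := by
    linear_combination (v * T.b - α * v ^ 2 * (v ^ 4 - 1) - v ^ 3 * t) * h4 + h
  have h1 : α * T.d = 0 := by
    linear_combination hd - (v ^ 2 - 1) * v ^ 2 * hvb - (v ^ 5 * (v ^ 4 - 1) * T.b +
      α * ((v ^ 4 - 1) * T.d + (v ^ 4 - 1) * (v ^ 8 + 1) + 2 - v ^ 2)) * h4
  exact mul_ne_zero hα T.d_ne_zero h1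

theorem QEJac.pow_eight_ne_one (hJ : T.QEJac v α) (hv : v ≠ 0) (hv10 : v ^ 10 ≠ 1)
    (hv12 : v ^ 12 ≠ 1) : v ^ 8 ≠ 1 := by
  intro h8
  have h : (v ^ 4 - 1) * (v ^ 4 + 1) = 0 := by linear_combination h8
  rcases mul_eq_zero.mp h with h | h
  · exact hv12 (by linear_combination (v ^ 8 + v ^ 4 + 1) * h)
  · exact hJ.pow_four_ne_neg_one hv hv10 h

theorem QEJac.exists_antisymmetric_relation (hJ : T.QEJac v α) (hv : v ≠ 0) (hv10 : v ^ 10 ≠ 1)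
    (hv12 : v ^ 12 ≠ 1) (hdim : Module.rank ℂ (T.X ⊗ T.X ⊗ T.X ⊗ T.X ⟶ 𝟙_ C) ≤ 5) :
    ∃ A B F : ℂ, T.comb A (-A) B (-B) F (-F) = 0 ∧ (A ≠ 0 ∨ B ≠ 0 ∨ F ≠ 0) := by
  obtain ⟨t, ht⟩ := T.exists_eq_smul_merge T.triangle
  obtain ⟨g, hg, hg0⟩ := exists_relation hdim
    ![𝟙 (T.X ⊗ T.X), T.cupCap, T.diagI, T.diagH, T.negCrossing, T.posCrossing]
  have hrel : T.comb (g 0) (g 1) (g 2) (g 3) (g 4) (g 5) = 0 := by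
    rw [Fin.sum_univ_six] at hg
    exact hg
  have hα := hJ.alpha_ne_zero hv hv10
  -- If no antisymmetric relation is nontrivial, the given relation is symmetric under rotation and
  -- its derived relation vanishes identically. The crossing coefficients go first, then those of
  -- `id` and `U`, and the cup removes the rest.
  by_contra! hK
  obtain ⟨h01, h23, h45⟩ := hK _ _ _ (comb_sub_rot_eq_zero (hJ.rotationInvariant hv) hrel)
  rw [sub_eq_zero] at h01 h23 h45
  obtain ⟨B, hB⟩ := hJ.derived_relation hv ht hrel
  obtain ⟨hA', -, hF'⟩ := hK _ _ _ hB
  rw [h45] at hF' hA'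
  have h5 : g 5 = 0 := by
    by_contra h5
    have e : α * g 5 * (v ^ 6 + 1) = 0 := by
      field_simp at hF'
      linear_combination (-1) * hF'
    have e' := (mul_eq_zero.mp e).resolve_left (mul_ne_zero hα h5)
    exact hv12 (by linear_combination (v ^ 6 - 1) * e')
  have h1 : g 1 = 0 := by
    rw [h5] at hA'
    have : g 1 * T.b = 0 := by linear_combination (-1) * hA'
    exact (mul_eq_zero.mp this).resolve_right T.b_ne_zero
  have h3 : g 3 = 0 := by
    have := hJ.cap_eq hv hrel
    rw [h45, h5, h01, h1] at this
    have : g 3 * T.b = 0 := by linear_combination this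
    exact (mul_eq_zero.mp this).resolve_right T.b_ne_zero
  apply hg0
  funext i
  match i with
  | 0 => exact h01.trans h1
  | 1 => exact h1
  | 2 => exact h23.trans h3
  | 3 => exact h3
  | 4 => exact h45.trans h5
  | 5 => exact h5

/-- A relation without crossings determines the third tree up to a crossing. -/
theorem QEJac.planar_relation (hJ : T.QEJac v α) (hv : v ≠ 0) (ht : T.triangle = t • T.merge)
    {A B : ℂ} (h : T.comb A (-A) B (-B) 0 (-0) = 0) (hAB : A ≠ 0 ∨ B ≠ 0) :
    T.comb (-α * v⁻¹) (-α * v ^ 7 - (T.b - t) * v ^ 12) (-v ^ 4 + v ^ 6) (v ^ 2)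
      (-α * v ^ 3 + (T.b - t)) 0 = 0 := by
  -- After normalizing, `I - H = (b - t)(id - U)`; substituting this for `H` in `σ ∘ H` and
  -- comparing with Jacobi gives the claim.
  have hA : A = -(B * (T.b - t)) := by
    linear_combination hJ.merge_eq hv ht h
  have hB : B ≠ 0 := by
    rintro rfl
    simp_all
  have h1 : T.comb (-(T.b - t)) (T.b - t) 1 (-1) 0 0 = 0 := by
    have := congrArg (B⁻¹ • ·) h
    simp only [smul_comb, smul_zero, hA] at this
    rw [← this]
    congr 1 <;> field_simp <;> ring
  have h2 : T.diagH = T.diagI - (T.b - t) • 𝟙 _ + (T.b - t) • T.cupCap := by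
    rw [← sub_eq_zero, ← neg_eq_zero, ← h1, comb]
    module
  have h3 := hJ.diagX_eq hv
  have h4 : T.diagI ≫ T.negCrossing = (-v ^ 6) • T.diagI := by
    rw [diagI, Category.assoc, hJ.split_negCrossing hv, Linear.comp_smul]
  have h5 : T.cupCap ≫ T.negCrossing = v ^ 12 • T.cupCap := by
    rw [cupCap, Category.assoc, hJ.twist_eq, Linear.comp_smul]
  conv_lhs at h3 => rw [h2]
  simp only [Preadditive.add_comp, Preadditive.sub_comp, Linear.smul_comp, h4, h5,
    Category.id_comp] at h3
  rw [← sub_eq_zero] at h3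
  rw [← neg_eq_zero, ← h3]
  simp only [comb]
  module

theorem QEJac.exists_crossing_relation (hJ : T.QEJac v α) (hv : v ≠ 0) (hv10 : v ^ 10 ≠ 1)
    (hv12 : v ^ 12 ≠ 1) (hdim : Module.rank ℂ (T.X ⊗ T.X ⊗ T.X ⊗ T.X ⟶ 𝟙_ C) ≤ 5) :
    ∃ A B F : ℂ, T.comb A (-A) B (-B) F (-F) = 0 ∧ F ≠ 0 := by
  obtain ⟨t, ht⟩ := T.exists_eq_smul_merge T.triangle
  have hR := hJ.rotationInvariant hv
  have hα := hJ.alpha_ne_zero hv hv10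
  obtain ⟨A, B, F, h, hne⟩ := hJ.exists_antisymmetric_relation hv hv10 hv12 hdim
  by_cases hF : F = 0
  · subst hF
    have h1 := hJ.planar_relation hv ht h (by simpa using hne)
    -- This is the only crossing coefficient. If it vanishes, closing the relation and its rotation
    -- with `Y` gives two equations that together force `v ^ 10 = 1` or `v ^ 6 = -1`.
    by_cases hc : -α * v ^ 3 + (T.b - t) = 0
    · exfalso
      have e1 := hJ.merge_eq hv ht h1
      have e2 := hJ.merge_eq hv ht (comb_rot_eq_zero hR h1)
      rw [hc] at e1 e2
      have hbt : T.b - t = α * v ^ 3 := by linear_combination hc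
      have key : α * ((v ^ 10 - 1) * (v ^ 6 + 1)) = 0 := by
        linear_combination v * (e1 - e2) + α * mul_inv_cancel₀ hv -
          (v ^ 13 + v ^ 7 - v ^ 5 - v ^ 3) * hbt
      rcases mul_eq_zero.mp ((mul_eq_zero.mp key).resolve_left hα) with h | h
      · exact hv10 (sub_eq_zero.mp h)
      · exact hv12 (by linear_combination (v ^ 6 - 1) * h)
    · exact ⟨_, _, _, comb_sub_rot_eq_zero hR h1, by simpa using hc⟩
  · exact ⟨A, B, F, h, hF⟩

theorem QEJac.eliminate (hJ : T.QEJac v α) (hv : v ≠ 0) (ht : T.triangle = t • T.merge)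
    {A B F : ℂ} (h : T.comb A (-A) B (-B) F (-F) = 0) (k : ℂ) :
    ∃ B' : ℂ, T.comb ((T.b + k) * A + F * α * (v ^ 7 + (v ^ 7)⁻¹ - v - v⁻¹))
      (-((T.b + k) * A + F * α * (v ^ 7 + (v ^ 7)⁻¹ - v - v⁻¹))) B' (-B')
      (F * (k - α * (v ^ 3 - (v ^ 3)⁻¹))) (-(F * (k - α * (v ^ 3 - (v ^ 3)⁻¹)))) = 0 := by
  obtain ⟨B', hB'⟩ := hJ.derived_relation hv ht h
  have h2 := congrArg₂ (fun x y => x + k • y) hB' h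
  simp only [smul_comb, comb_add, smul_zero, add_zero] at h2
  refine ⟨B' + k * B, Eq.trans ?_ h2⟩
  congr 1 <;> ring

theorem QEJac.denominator_ne_zero (hJ : T.QEJac v α) (hv : v ≠ 0) (hv10 : v ^ 10 ≠ 1)
    (hv12 : v ^ 12 ≠ 1) (hdim : Module.rank ℂ (T.X ⊗ T.X ⊗ T.X ⊗ T.X ⟶ 𝟙_ C) ≤ 5) :
    T.b + (v ^ 3 - (v ^ 3)⁻¹) * α ≠ 0 := by
  intro hb
  obtain ⟨t, ht⟩ := T.exists_eq_smul_merge T.triangle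
  have hR := hJ.rotationInvariant hv
  have hα := hJ.alpha_ne_zero hv hv10
  have h8 := hJ.pow_eight_ne_one hv hv10 hv12
  have h4 := hJ.pow_four_ne_neg_one hv hv10
  obtain ⟨A, B, F, h, hF⟩ := hJ.exists_crossing_relation hv hv10 hv12 hdim
  -- This multiple cancels the crossings, and `b + [3]α = 0` removes `A` from the coefficient of `id
  -- - U`. What remains of it factors through `(v ^ 6 - 1)(v ^ 8 - 1)`, hence is nonzero, and
  -- `planar_relation` applies.
  obtain ⟨B', h1⟩ := hJ.eliminate hv ht h (α * (v ^ 3 - (v ^ 3)⁻¹))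
  rw [sub_self, mul_zero] at h1
  have h2 := hJ.planar_relation hv ht h1 (Or.inl ?_)
  · have hb' : T.b = -(v ^ 3 - (v ^ 3)⁻¹) * α := by linear_combination hb
    have ht' : t = -(v ^ 3 - (v ^ 3)⁻¹ + v - v⁻¹) * α := by
      have := hJ.triangle_value hv ht
      rw [hb'] at this
      apply mul_left_cancel₀ (mul_ne_zero (pow_ne_zero 3 hv) h4)
      rw [this]
      field_simp
      ring
    have e2 := hJ.merge_eq hv ht (comb_rot_eq_zero hR h2)
    rw [ht', hb'] at e2
    have key : α * ((v ^ 10 - 1) * (v ^ 6 + 1) * (v ^ 4 - v ^ 2 + 1)) = 0 := by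
      have := congrArg (v ^ 7 * ·) e2
      simp only [mul_zero] at this
      rw [← neg_eq_zero, ← this]
      field_simp
      ring
    rcases mul_eq_zero.mp ((mul_eq_zero.mp key).resolve_left hα) with h | h
    · rcases mul_eq_zero.mp h with h | h
      · exact hv10 (sub_eq_zero.mp h)
      · exact hv12 (by linear_combination (v ^ 6 - 1) * h)
    · exact hv12 (by linear_combination (v ^ 6 - 1) * (v ^ 2 + 1) * h)
  · have e : (T.b + α * (v ^ 3 - (v ^ 3)⁻¹)) * A + F * α * (v ^ 7 + (v ^ 7)⁻¹ - v - v⁻¹) =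
        F * α * (v ^ 7)⁻¹ * (v ^ 6 - 1) * (v ^ 8 - 1) := by
      have : T.b + α * (v ^ 3 - (v ^ 3)⁻¹) = 0 := by linear_combination hb
      rw [this]
      field_simp
      ring
    rw [e]
    have h6 : v ^ 6 - 1 ≠ 0 := fun h => hv12 (by linear_combination (v ^ 6 + 1) * h)
    exact mul_ne_zero (mul_ne_zero (mul_ne_zero (mul_ne_zero hF hα)
      (inv_ne_zero (pow_ne_zero 7 hv))) h6) (sub_ne_zero.mpr h8)

/-- The crossing relation, cleared of denominators. -/
theorem QEJac.crossing_relation (hJ : T.QEJac v α) (hv : v ≠ 0) (hv10 : v ^ 10 ≠ 1)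
    (hv12 : v ^ 12 ≠ 1) (hdim : Module.rank ℂ (T.X ⊗ T.X ⊗ T.X ⊗ T.X ⟶ 𝟙_ C) ≤ 5) :
    T.comb (-(Psi1 v ^ 2 * Psi2 v * Psi3 v * Psi4 v * α)) (Psi1 v ^ 2 * Psi2 v * Psi3 v * Psi4 v * α)
      (Psi1 v * Psi2 v * Psi3 v * Psi4 v) (-(Psi1 v * Psi2 v * Psi3 v * Psi4 v))
      (T.b + qnum v 3 * α) (-(T.b + qnum v 3 * α)) = 0 := by
  obtain ⟨t, ht⟩ := T.exists_eq_smul_merge T.triangle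
  obtain ⟨A, B, F, h, hF⟩ := hJ.exists_crossing_relation hv hv10 hv12 hdim
  -- This multiple cancels the unknown `A`, leaving `id - U` and `σ - σ⁻¹` with known multiples of
  -- `F`.
  obtain ⟨B', h1⟩ := hJ.eliminate hv ht h (-T.b)
  have h2 := congrArg (-F⁻¹ • ·) h1
  simp only [smul_comb, smul_zero] at h2
  have hA : -F⁻¹ * ((T.b + -T.b) * A + F * α * (v ^ 7 + (v ^ 7)⁻¹ - v - v⁻¹)) =
      -(Psi1 v ^ 2 * Psi2 v * Psi3 v * Psi4 v * α) := by
    simp only [Psi1, Psi2, Psi3, Psi4, zpow_neg, zpow_ofNat]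
    field_simp
    ring
  have hF' : -F⁻¹ * (F * (-T.b - α * (v ^ 3 - (v ^ 3)⁻¹))) = T.b + qnum v 3 * α := by
    simp only [qnum, zpow_neg, zpow_ofNat]
    field_simp
    ring
  -- The cup turns the relation into an equation for this coefficient times `b`, once `d` is
  -- eliminated by the circle equation.
  have hB : -F⁻¹ * B' = Psi1 v * Psi2 v * Psi3 v * Psi4 v := by
    have hc := hJ.cap_eq hv h2
    have hd := hJ.circle_value hv
    simp only [mul_neg, hA, hF'] at hc
    apply mul_right_cancel₀ T.b_ne_zero
    linear_combination (norm := skip) (-1) * hc +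
      Psi1 v ^ 2 * Psi2 v * Psi3 v * Psi4 v * (v ^ 8)⁻¹ * hd
    simp only [qnum, Psi1, Psi2, Psi3, Psi4, zpow_neg, zpow_ofNat]
    field_simp
    ring
  simp only [mul_neg, hA, hF', hB, neg_neg] at h2
  exact h2

theorem QEJac.triangle_eq (hJ : T.QEJac v α) (hv : v ≠ 0) (hv10 : v ^ 10 ≠ 1) :
    T.triangle = ((T.b - qnum v 5 * α) / qsum v 2) • T.merge := by
  obtain ⟨t, ht⟩ := T.exists_eq_smul_merge T.triangle
  have h4 := hJ.pow_four_ne_neg_one hv hv10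
  rw [ht]
  congr 1
  have h := hJ.triangle_value hv ht
  have e : t = (v ^ 5 * T.b - α * (v ^ 10 - 1)) / (v ^ 3 * (v ^ 4 + 1)) := by
    rw [eq_div_iff (mul_ne_zero (pow_ne_zero 3 hv) h4), ← h]
    ring
  have e2 : qsum v 2 = (v ^ 4 + 1) / v ^ 2 := by
    simp only [qsum, zpow_neg, zpow_ofNat]
    field_simp
  rw [e, e2]
  simp only [qnum, zpow_neg, zpow_ofNat]
  field_simp

theorem QEJac.circle_eq_value (hJ : T.QEJac v α) (hv : v ≠ 0) (hv10 : v ^ 10 ≠ 1) :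
    T.d = -(qnum v 5 * T.b / α) - qsum v 8 := by
  have hα := hJ.alpha_ne_zero hv hv10
  have h := hJ.circle_value hv
  apply mul_left_cancel₀ (mul_ne_zero (pow_ne_zero 8 hv) hα)
  linear_combination (norm := skip) h
  simp only [qnum, qsum, zpow_neg, zpow_ofNat]
  field_simp
  ring

theorem QEJac.psi_ne_zero (hJ : T.QEJac v α) (hv : v ≠ 0) (hv10 : v ^ 10 ≠ 1)
    (hv12 : v ^ 12 ≠ 1) : Psi1 v ≠ 0 ∧ Psi2 v ≠ 0 ∧ Psi3 v ≠ 0 ∧ Psi4 v ≠ 0 := by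
  have h4 := hJ.pow_four_ne_neg_one hv hv10
  have e1 : Psi1 v = (v ^ 2 - 1) * v⁻¹ := by
    simp only [Psi1, zpow_neg, zpow_one]; field_simp
  have e2 : Psi2 v = (v ^ 2 + 1) * v⁻¹ := by
    simp only [Psi2, zpow_neg, zpow_one]; field_simp
  have e3 : Psi3 v = (v ^ 4 + v ^ 2 + 1) * (v ^ 2)⁻¹ := by
    simp only [Psi3, zpow_neg, zpow_ofNat]; field_simp
  have e4 : Psi4 v = (v ^ 4 + 1) * (v ^ 2)⁻¹ := by
    simp only [Psi4, zpow_neg, zpow_ofNat]; field_simp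
  rw [e1, e2, e3, e4]
  have hi := inv_ne_zero hv
  have hi2 := inv_ne_zero (pow_ne_zero 2 hv)
  refine ⟨mul_ne_zero (fun h => hv12 ?_) hi, mul_ne_zero (fun h => hv12 ?_) hi,
    mul_ne_zero (fun h => hv12 ?_) hi2, mul_ne_zero h4 hi2⟩
  · linear_combination (v ^ 4 + v ^ 2 + 1) * (v ^ 6 + 1) * h
  · linear_combination (v ^ 6 - 1) * (v ^ 4 - v ^ 2 + 1) * h
  · linear_combination (v ^ 2 - 1) * (v ^ 6 + 1) * h

theorem qnum_three (v : ℂ) : qnum v 3 = v ^ 3 - (v ^ 3)⁻¹ := by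
  simp only [qnum, zpow_neg, zpow_ofNat]

theorem QEJac.qeCross (hJ : T.QEJac v α) (hv : v ≠ 0) (hv10 : v ^ 10 ≠ 1)
    (hv12 : v ^ 12 ≠ 1) (hdim : Module.rank ℂ (T.X ⊗ T.X ⊗ T.X ⊗ T.X ⟶ 𝟙_ C) ≤ 5) :
    T.QECross v α := by
  have h := hJ.crossing_relation hv hv10 hv12 hdim
  have h0 := hJ.denominator_ne_zero hv hv10 hv12 hdim
  rw [← qnum_three] at h0
  have h1 := congrArg ((T.b + qnum v 3 * α)⁻¹ • ·) h
  simp only [smul_zero] at h1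
  rw [QECross, ← h1, comb]
  match_scalars <;> field_simp

theorem QEJac.qeSq (hJ : T.QEJac v α) (hv : v ≠ 0) (hv10 : v ^ 10 ≠ 1)
    (hv12 : v ^ 12 ≠ 1) (hdim : Module.rank ℂ (T.X ⊗ T.X ⊗ T.X ⊗ T.X ⟶ 𝟙_ C) ≤ 5) :
    T.QESq v α := by
  have ht := hJ.triangle_eq hv hv10
  obtain ⟨h1, h2, h3, h4⟩ := hJ.psi_ne_zero hv hv10 hv12
  have h := hJ.crossing_relation hv hv10 hv12 hdim
  have h5 := hJ.diagH_comb hv ht (-(Psi1 v ^ 2 * Psi2 v * Psi3 v * Psi4 v * α))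
    (Psi1 v ^ 2 * Psi2 v * Psi3 v * Psi4 v * α)
    (Psi1 v * Psi2 v * Psi3 v * Psi4 v) (-(Psi1 v * Psi2 v * Psi3 v * Psi4 v))
    (T.b + qnum v 3 * α) (-(T.b + qnum v 3 * α))
  rw [h, Limits.comp_zero] at h5
  -- Adding `-α v⁻³` times the crossing relation cancels the positive crossing, and the outer factor
  -- makes the square monic.
  have h6 := congrArg₂ (fun x y => (-(Psi1 v * Psi2 v * Psi3 v * Psi4 v)⁻¹) •
    (x + (-(α * (v ^ 3)⁻¹)) • y)) h5.symm h
  simp only [smul_zero, add_zero] at h6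
  have e4 : qsum v 2 = Psi4 v := rfl
  have h1' : v ^ 2 - 1 ≠ 0 := fun e => hv12 (by
    linear_combination (v ^ 4 + v ^ 2 + 1) * (v ^ 6 + 1) * e)
  have h2' : v ^ 2 + 1 ≠ 0 := fun e => hv12 (by
    linear_combination (v ^ 6 - 1) * (v ^ 4 - v ^ 2 + 1) * e)
  have h3' : v ^ 4 + v ^ 2 + 1 ≠ 0 := fun e => hv12 (by
    linear_combination (v ^ 2 - 1) * (v ^ 6 + 1) * e)
  have h3'' : v ^ 2 * (v ^ 2 + 1) + 1 ≠ 0 := fun e => h3' (by linear_combination e)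
  have h4' := hJ.pow_four_ne_neg_one hv hv10
  have e1 : Psi1 v = (v ^ 2 - 1) / v := by
    simp only [Psi1, zpow_neg, zpow_one]; field_simp
  have e2 : Psi2 v = (v ^ 2 + 1) / v := by
    simp only [Psi2, zpow_neg, zpow_one]; field_simp
  have e3 : Psi3 v = (v ^ 4 + v ^ 2 + 1) / v ^ 2 := by
    simp only [Psi3, zpow_neg, zpow_ofNat]; field_simp
  have e4' : Psi4 v = (v ^ 4 + 1) / v ^ 2 := by
    simp only [Psi4, zpow_neg, zpow_ofNat]; field_simp
  rw [QESq, ← h6]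
  simp only [comb, e4, coeffI, coeffH, coeffCupCap, coeffId, qnum, Psi6, e1, e2, e3, e4',
    zpow_neg, zpow_ofNat]
  match_scalars <;> (field_simp; try ring)

end TrivalentRibbon

theorem theorem1p10 {C : Type u} [Category.{w} C] [Preadditive C] [Linear ℂ C]
    [MonoidalCategory C] [MonoidalPreadditive C] [MonoidalLinear ℂ C] [BraidedCategory C]
    [RigidCategory C] [RibbonCategory C] (T : TrivalentRibbon C)
    (hdim : Module.rank ℂ (T.X ⊗ T.X ⊗ T.X ⊗ T.X ⟶ 𝟙_ C) ≤ 5)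
    (v α : ℂ) (hv : v ≠ 0) (hJac : T.QEJac v α) (hv10 : v ^ 10 ≠ 1) (hv12 : v ^ 12 ≠ 1) :
    α ≠ 0 ∧ T.b + qnum v 3 * α ≠ 0 ∧ v ^ 8 ≠ 1 ∧
      T.d = -(qnum v 5 * T.b / α) - qsum v 8 ∧
      T.triangle = ((T.b - qnum v 5 * α) / qsum v 2) • T.merge ∧
      T.QESq v α ∧ T.QECross v α := by
  refine ⟨hJac.alpha_ne_zero hv hv10, ?_, hJac.pow_eight_ne_one hv hv10 hv12,
    hJac.circle_eq_value hv hv10, hJac.triangle_eq hv hv10, hJac.qeSq hv hv10 hv12 hdim,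
    hJac.qeCross hv hv10 hv12 hdim⟩
  rw [TrivalentRibbon.qnum_three]
  exact hJac.denominator_ne_zero hv hv10 hv12 hdim
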